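/- Let $m\ge 1$ and, for $i,j\in\{1,\dots,m\}$ with $i\neq j$, let $\gamma_{ij}:\mathbb R\to\mathbb R$ be locally Lipschitz functions forming a connected interconnection, that is: - $\gamma_{ij}(0)=0$ and $s\,\gamma_{ij}(s)\ge 0$ for all $s\in\mathbb R$; - either $\gamma_{ij}\equiv 0$, or there is a continuous, strictly increasing $\alpha:\mathbb R_{\ge0}\to\mathbb R_{\ge 0}$ with $\alpha(0)=0$ such that $|\gamma_{ij}(s)|\ge\alpha(|s|)$ for all $s\in\mathbb R$; - the directed graph with nodes $1,\dots,m$ and an edge $(i,j)$ exactly when $i\ne j$ and $\gamma_{ij}\not\equiv 0$ has a node to which there is a directed path from every other node. For $\omega>0$ consider on $(\mathbb R^2)^m=\mathbb R^{2m}$ the time-periodic system $\dot x=h^{c}(x,\omega t)$ given by $$\dot x_i=\sum_{j\ne i} e(\omega t)\,\gamma_{ij}\big(e(\omega t)^{T}(x_j-x_i)\big),\qquad e(\varphi):=\begin{bmatrix}-\sin\varphi\\ \cos\varphi\end{bmatrix},\qquad i=1,\dots,m$$ (the array $\dot q_i=\omega p_i$, $\dot p_i=-\omega q_i+\sum_{j\neq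 i}\gamma_{ij}(p_j-p_i)$ of coupled harmonic oscillators written in rotating coordinates). Let $\mathcal A:=\{x\in\mathbb R^{2m}: x_i=x_j\text{ for all }i,j\}$ be the synchronization manifold and let $|x|_{\mathcal A}$ be the Euclidean distance from $x$ to $\mathcal A$. **Theorem.** The closed set $\mathcal A$ is semiglobally practically asymptotically stable with respect to $\omega$: for each pair $(\Delta,\delta)$ of positive numbers there exists $\omega^*>0$ such that for every $\omega\ge\omega^*$ the following hold. - (a) For each $r>\delta$ there exists $\varepsilon>0$ such that $|x(t_0)|_{\mathcal A}\le\varepsilon$ implies $|x(t)|_{\mathcal A}\le r$ for all $t\ge t_0$. - (b) For each $\varepsilon<\Delta$ there exists $r>0$ such that $|x(t_0)|_{\mathcal A}\le\varepsilon$ implies $|x(t)|_{\mathcal A}\le r$ for all $t\ge t_0$. - (c) For each $r<\Delta$ and $\varepsilon>\delta$ there exists $T>0$ such that $|x(t_0)|_{\mathcal A}\le r$ implies $|x(t)|_{\mathcal A}\le\varepsilon$ for all $t\ge t_0+T$. Here the implications hold for every initial time $t_0\in\mathbb R$ and every solution $x(\cdot)$ of the system starting at $t_0$, with $\varepsilon$,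 $r$, $T$ not depending on $t_0$ or on the solution; in each case solutions from the initial states in question exist for all $t\ge t_0$. -/

import Mathlib

open scoped NNReal

noncomputable section

namespace OscSync

/-- Functions of class `K`: continuous, zero at zero, strictly increasing on `[0, ∞)`. -/
structure ClassK (α : ℝ≥0 → ℝ≥0) : Prop where
  continuous : Continuous α
  map_zero : α 0 = 0
  strictMono : StrictMono α

/-- An interconnection: for all `i ≠ j`, the function `γ i j` satisfies
(G1) `γ i j 0 = 0` and `s * γ i j s ≥ 0`, and
(G2) either `γ i j` vanishes identically or `|γ i j s| ≥ α |s|` for some `α` of class `K`.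
The diagonal entries `γ i i` play no role. -/
structure IsInterconnection {m : ℕ} (γ : Fin m → Fin m → ℝ → ℝ) : Prop where
  map_zero : ∀ i j, i ≠ j → γ i j 0 = 0
  mul_nonneg : ∀ i j, i ≠ j → ∀ s, 0 ≤ s * γ i j s
  zero_or_bound : ∀ i j, i ≠ j →
    γ i j = 0 ∨ ∃ α : ℝ≥0 → ℝ≥0, ClassK α ∧ ∀ s : ℝ, (α ‖s‖₊ : ℝ) ≤ |γ i j s|

/-- The graph of an interconnection: `(i, j)` is an edge iff `i ≠ j` and `γ i j ≠ 0`. -/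
def couplingGraph {m : ℕ} (γ : Fin m → Fin m → ℝ → ℝ) : Digraph (Fin m) where
  Adj i j := i ≠ j ∧ γ i j ≠ 0

/-- A directed graph is connected if it has a node to which there is a directed path from every
other node. -/
def IsConnected {V : Type*} (G : Digraph V) : Prop :=
  ∃ r, ∀ v, v ≠ r → Relation.ReflTransGen G.Adj v r

/-- The plane `ℝ²` with its Euclidean norm. -/
abbrev Plane : Type := EuclideanSpace ℝ (Fin 2)

/-- `ℝ²ᵐ = (ℝ²)ᵐ` with its Euclidean norm. -/
abbrev ArrayState (m : ℕ) : Type := PiLp 2 (fun _ : Fin m => Plane)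

/-- The vector `[-sin φ, cos φ]ᵀ`. -/
def dir (φ : ℝ) : Plane := !₂[-Real.sin φ, Real.cos φ]

/-- The right-hand side of the rotated array of harmonic oscillators; its `i`-th block is
`∑_{j ≠ i} [-sin φ, cos φ]ᵀ γ i j ([-sin φ, cos φ] (x j - x i))`. -/
def rotatedArray {m : ℕ} (γ : Fin m → Fin m → ℝ → ℝ) (x : ArrayState m) (φ : ℝ) : ArrayState m :=
  WithLp.toLp 2 fun i =>
    ∑ j ∈ Finset.univ.erase i, γ i j (inner ℝ (dir φ) (x j - x i)) • dir φ

/-- The synchronization manifold. -/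
def syncManifold (m : ℕ) : Set (ArrayState m) :=
  {x | ∀ i j, x i = x j}

section Stability

variable {E : Type*} [NormedAddCommGroup E] [NormedSpace ℝ E]

/-- `x` solves `ẋ = f t x` on the time set `I` (one-sided derivatives at end points). -/
def IsSolutionOn (f : ℝ → E → E) (I : Set ℝ) (x : ℝ → E) : Prop :=
  ∀ t ∈ I, HasDerivWithinAt x (f t (x t)) I t

/-- Whatever the initial time `t₀`, from every initial state at distance at most `a` from `S` a
solution exists for all `t ≥ t₀`, and every solution that starts there (also one that is given on a
bounded time interval only) is at distance at most `b` from `S` at all times `t ≥ t₀ + T` of its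
interval of definition. -/
def StaysWithin (f : ℝ → E → E) (S : Set E) (a T b : ℝ) : Prop :=
  ∀ (t₀ : ℝ) (x₀ : E), Metric.infDist x₀ S ≤ a →
    (∃ x : ℝ → E, x t₀ = x₀ ∧ IsSolutionOn f (Set.Ici t₀) x) ∧
    ∀ (t₁ : ℝ) (x : ℝ → E), x t₀ = x₀ → IsSolutionOn f (Set.Icc t₀ t₁) x →
      ∀ t ∈ Set.Icc t₀ t₁, t₀ + T ≤ t → Metric.infDist (x t) S ≤ b

/-- Semiglobal practical asymptotic stability, with respect to `ω`, of the closed set `S` for the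
system `ẋ = g x ω t`. -/
def SemigloballyPracticallyAsymptoticallyStable (g : E → ℝ → ℝ → E) (S : Set E) : Prop :=
  IsClosed S ∧
  ∀ Δ > (0 : ℝ), ∀ δ > (0 : ℝ), ∃ ωstar > (0 : ℝ), ∀ ω ≥ ωstar,
    (∀ r > δ, ∃ ε > (0 : ℝ), StaysWithin (fun t x => g x ω t) S ε 0 r) ∧
    (∀ ε < Δ, ∃ r > (0 : ℝ), StaysWithin (fun t x => g x ω t) S ε 0 r) ∧
    (∀ r < Δ, ∀ ε > δ, ∃ T > (0 : ℝ), StaysWithin (fun t x => g x ω t) S r T ε)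

end Stability

end OscSync

end

/-! Averaging over the fast rotation turns each coupling into a central force: the mean of `f (⟪dir
φ, v⟫) • dir φ` is `κ • v` with `0 ≤ κ ≤ L`, and `κ > 0` if `f ≠ 0` and `v ≠ 0`
(`exists_averagedCoupling_eq_smul`). Along a solution of the averaged array, the projection onto any
fixed direction thus obeys a scalar linear consensus equation with nonnegative weights, so a maximum
principle holds and the largest distance between two blocks, `disagreement`, does not grow.

The decrease over one unit of time is strict. Otherwise the maximum and the minimum in some
direction would both persist, and both would spread along the edges to the root, which cannot attain
both (`averaged_disagreement_lt`). Compactness modulo translations makes the decrease uniform on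
bounded levels away from zero.

On unit time intervals the true solution is within `C / ω` of the averaged one, uniformly in the
initial time and state (`exists_averaging_bound`). For large `ω` this error consumes at most half of
the decrease, and iterating unit steps gives the practical bounds. Clamping the arguments of the
couplings makes all constants global; on the levels reached by the solutions considered it changes
nothing. Finally `disagreement` and the distance to the manifold bound each other up to the factors
`2` and `m`. -/

namespace OscSync

/-! ### Existence and uniqueness for bounded, globally Lipschitz fields -/

section ODE

variable {E : Type*} [NormedAddCommGroup E] [NormedSpace ℝ E]

theorem IsSolutionOn.mono {f : ℝ → E → E} {I J : Set ℝ} {x : ℝ → E}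
    (h : IsSolutionOn f I x) (hJ : J ⊆ I) : IsSolutionOn f J x :=
  fun t ht => (h t (hJ ht)).mono hJ

theorem IsSolutionOn.congr {f g : ℝ → E → E} {I : Set ℝ} {x : ℝ → E}
    (h : IsSolutionOn f I x) (hfg : ∀ t ∈ I, f t (x t) = g t (x t)) : IsSolutionOn g I x :=
  fun t ht => hfg t ht ▸ h t ht

theorem IsSolutionOn.continuousOn {f : ℝ → E → E} {I : Set ℝ} {x : ℝ → E}
    (h : IsSolutionOn f I x) : ContinuousOn x I :=
  fun t ht => (h t ht).continuousWithinAt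

theorem IsSolutionOn.hasDerivWithinAt_Ici {f : ℝ → E → E} {a b : ℝ} {x : ℝ → E}
    (h : IsSolutionOn f (Set.Icc a b) x) {t : ℝ} (ht : t ∈ Set.Ico a b) :
    HasDerivWithinAt x (f t (x t)) (Set.Ici t) t :=
  (h t ⟨ht.1, ht.2.le⟩).mono_of_mem_nhdsWithin
    (Filter.mem_of_superset (Icc_mem_nhdsGE ht.2) (Set.Icc_subset_Icc_left ht.1))

theorem IsSolutionOn.eqOn {f : ℝ → E → E} {K : ℝ≥0} (hK : ∀ t, LipschitzWith K (f t))
    {a b : ℝ} {x y : ℝ → E} (hx : IsSolutionOn f (Set.Icc a b) x)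
    (hy : IsSolutionOn f (Set.Icc a b) y) (h : x a = y a) : Set.EqOn x y (Set.Icc a b) :=
  ODE_solution_unique hK hx.continuousOn (fun _ ht => hx.hasDerivWithinAt_Ici ht)
    hy.continuousOn (fun _ ht => hy.hasDerivWithinAt_Ici ht) h

/-- Translating time in a solution. -/
theorem IsSolutionOn.comp_const_add {f : ℝ → E → E} {I J : Set ℝ} {x : ℝ → E} (c : ℝ)
    (h : IsSolutionOn f I x) (hJ : ∀ t ∈ J, c + t ∈ I) :
    IsSolutionOn (fun t => f (c + t)) J (fun t => x (c + t)) := by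
  intro t ht
  have h1 : HasDerivWithinAt (fun t => c + t) 1 J t :=
    ((hasDerivAt_id t).const_add c).hasDerivWithinAt
  simpa [Function.comp_def] using
    (h (c + t) (hJ t ht)).scomp t h1 (fun s hs => hJ s hs)

variable [CompleteSpace E]

/-- The bound `B` holds in the whole space, so the Picard–Lindelöf ball may have radius `B * T` and
the length `T` is arbitrary. -/
theorem exists_isSolutionOn_Icc {f : ℝ → E → E} {K B : ℝ≥0} (hK : ∀ t, LipschitzWith K (f t))
    (hc : ∀ x, Continuous fun t => f t x) (hB : ∀ t x, ‖f t x‖ ≤ B) (t₀ T : ℝ) (hT : 0 ≤ T)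
    (x₀ : E) : ∃ x : ℝ → E, x t₀ = x₀ ∧ IsSolutionOn f (Set.Icc t₀ (t₀ + T)) x := by
  have h : IsPicardLindelof f (tmin := t₀) (tmax := t₀ + T) ⟨t₀, by simp [hT]⟩ x₀
      (B * ⟨T, hT⟩) 0 B K :=
    { lipschitzOnWith := fun t _ => (hK t).lipschitzOnWith
      continuousOn := fun x _ => (hc x).continuousOn
      norm_le := fun t _ x _ => hB t x
      mul_max_le := by simp [hT]; rfl }
  exact h.exists_eq_forall_mem_Icc_hasDerivWithinAt₀

theorem exists_isSolutionOn_Ici {f : ℝ → E → E} {K B : ℝ≥0} (hK : ∀ t, LipschitzWith K (f t))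
    (hc : ∀ x, Continuous fun t => f t x) (hB : ∀ t x, ‖f t x‖ ≤ B) (t₀ : ℝ)
    (x₀ : E) : ∃ x : ℝ → E, x t₀ = x₀ ∧ IsSolutionOn f (Set.Ici t₀) x := by
  choose y hy0 hy using fun n : ℕ =>
    exists_isSolutionOn_Icc hK hc hB t₀ (n : ℝ) n.cast_nonneg x₀
  -- By uniqueness the solutions on the intervals of length `n` agree, so they can be glued by using
  -- at `t` the shortest one that reaches `t`.
  have key : ∀ (n : ℕ) (t : ℝ), t ∈ Set.Icc t₀ (t₀ + n) → y ⌈t - t₀⌉₊ t = y n t := by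
    intro n t ht
    have h1 : ⌈t - t₀⌉₊ ≤ n := Nat.ceil_le.2 (by linarith [ht.2])
    have h2 : (⌈t - t₀⌉₊ : ℝ) ≤ n := by exact_mod_cast h1
    refine (hy _).eqOn hK ((hy n).mono (Set.Icc_subset_Icc_right (by linarith))) ?_
      ⟨ht.1, by linarith [Nat.le_ceil (t - t₀)]⟩
    rw [hy0, hy0]
  refine ⟨fun t => y ⌈t - t₀⌉₊ t, hy0 _, fun t (ht : t₀ ≤ t) => ?_⟩
  obtain ⟨n, hn⟩ := exists_nat_gt (t - t₀)
  have htn : t ∈ Set.Icc t₀ (t₀ + n) := ⟨ht, by linarith⟩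
  have h1 : HasDerivWithinAt (y n) (f t (y n t)) (Set.Ici t₀) t := by
    refine (hy n t htn).mono_of_mem_nhdsWithin ?_
    rw [← Set.Ici_inter_Iic]
    exact Filter.inter_mem self_mem_nhdsWithin
      (mem_nhdsWithin_of_mem_nhds (Iic_mem_nhds (by linarith)))
  have h2 : (fun t => y ⌈t - t₀⌉₊ t) =ᶠ[nhdsWithin t (Set.Ici t₀)] y n := by
    filter_upwards [self_mem_nhdsWithin,
      mem_nhdsWithin_of_mem_nhds (Iic_mem_nhds (show t < t₀ + n by linarith))] with s hs hs'
    exact key n s ⟨hs, hs'⟩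
  have h3 := h1.congr_of_eventuallyEq h2 (key n t htn)
  rw [← key n t htn] at h3
  exact h3

end ODE

/-! ### Averaging on bounded time intervals -/

section Averaging

variable {E : Type*} [NormedAddCommGroup E] [NormedSpace ℝ E]

open intervalIntegral

/-- The integral of a fast oscillating periodic field of mean zero along a Lipschitz curve is of the
order of the period. -/
theorem norm_integral_oscillating_le {g : E → ℝ → E} {K B A : ℝ≥0}
    (hc : Continuous (Function.uncurry g))
    (hK : ∀ φ, LipschitzWith K fun x => g x φ) (hB : ∀ x φ, ‖g x φ‖ ≤ B)
    {P : ℝ} (hP : 0 < P) (hmean : ∀ x s, ∫ φ in s..s + P, g x φ = 0)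
    {y : ℝ → E} (hy : LipschitzWith A y) {t : ℝ} (ht : 0 ≤ t) :
    ‖∫ s in (0)..t, g (y s) s‖ ≤ P * (B + K * A * t) := by
  have hyc := hy.continuous
  have hcont : Continuous fun s => g (y s) s := by fun_prop
  have hcx : ∀ x, Continuous fun s => g x s := fun x => by fun_prop
  -- Over one period the field with frozen state integrates to zero; the state moves by at most `A *
  -- P`, which leaves `K * A * P` over a length `P`.
  have hstep : ∀ s, ‖∫ σ in s..s + P, g (y σ) σ‖ ≤ K * A * P * P := by
    intro s
    have h1 : ∫ σ in s..s + P, g (y σ) σ = ∫ σ in s..s + P, (g (y σ) σ - g (y s) σ) := by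
      rw [integral_sub (hcont.intervalIntegrable _ _) ((hcx _).intervalIntegrable _ _),
        hmean, sub_zero]
    rw [h1]
    have h2 := norm_integral_le_of_norm_le_const (a := s) (b := s + P)
      (f := fun σ => g (y σ) σ - g (y s) σ) (C := K * A * P) ?_
    · simpa [abs_of_pos hP] using h2
    · intro σ hσ
      rw [Set.uIoc_of_le (by linarith)] at hσ
      have h3 := (hK σ).dist_le_mul (y σ) (y s)
      have h4 := hy.dist_le_mul σ s
      rw [dist_eq_norm] at h3
      have h5 : dist σ s ≤ P := by
        rw [Real.dist_eq, abs_of_nonneg (by linarith [hσ.1])]; linarith [hσ.2]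
      calc _ ≤ _ := h3
        _ ≤ K * (A * P) := by gcongr; exact h4.trans (by gcongr)
        _ = _ := by ring
  -- Full periods are split off at the end of the interval; the remaining piece, shorter than a
  -- period, costs `P * B`.
  have hind : ∀ n : ℕ, ∀ t, 0 ≤ t → t ≤ (n + 1) * P →
      ‖∫ s in (0)..t, g (y s) s‖ ≤ P * (B + K * A * t) := by
    intro n
    have hsmall : ∀ t, 0 ≤ t → t ≤ P →
        ‖∫ s in (0)..t, g (y s) s‖ ≤ P * (B + K * A * t) := by
      intro t h0 ht
      have h2 := norm_integral_le_of_norm_le_const (a := 0) (b := t)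
        (f := fun σ => g (y σ) σ) (C := B) (fun σ _ => hB _ _)
      rw [sub_zero, abs_of_nonneg h0] at h2
      calc _ ≤ _ := h2
        _ ≤ B * P := by gcongr
        _ = P * (B + 0) := by ring
        _ ≤ _ := by gcongr; positivity
    induction n with
    | zero => intro t h0 ht; exact hsmall t h0 (by simpa using ht)
    | succ n ih =>
      intro t h0 ht
      push_cast at ht
      by_cases htP : t ≤ P
      · exact hsmall t h0 htP
      · push Not at htP
        have h1 := ih (t - P) (by linarith) (by linarith)
        have h2 := hstep (t - P)
        rw [sub_add_cancel] at h2
        rw [← integral_add_adjacent_intervals (hcont.intervalIntegrable 0 (t - P))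
          (hcont.intervalIntegrable (t - P) t)]
        calc _ ≤ _ := norm_add_le _ _
          _ ≤ P * (B + K * A * (t - P)) + K * A * P * P := add_le_add h1 h2
          _ = _ := by ring
  obtain ⟨n, hn⟩ := exists_nat_gt (t / P)
  refine hind n t ht ?_
  rw [div_lt_iff₀ hP] at hn
  nlinarith

variable [CompleteSpace E]

/-- Averaging on a bounded time interval: solutions of a fast oscillating field are close to
solutions of its mean. -/
theorem exists_averaging_bound {h : E → ℝ → E} {hbar : E → E} {K B : ℝ≥0}
    (hc : Continuous (Function.uncurry h))
    (hK : ∀ φ, LipschitzWith K fun x => h x φ) (hB : ∀ x φ, ‖h x φ‖ ≤ B)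
    (hKbar : LipschitzWith K hbar) (hBbar : ∀ x, ‖hbar x‖ ≤ B)
    {P : ℝ} (hP : 0 < P) (hmean : ∀ x s, ∫ φ in s..s + P, (h x φ - hbar x) = 0) :
    ∃ C > (0 : ℝ), ∀ ω > (0 : ℝ), ∀ (p : ℝ) (y z : ℝ → E), y 0 = z 0 →
      IsSolutionOn (fun _ => hbar) (Set.Icc 0 1) y →
      IsSolutionOn (fun t x => h x (p + ω * t)) (Set.Icc 0 1) z →
      ∀ t ∈ Set.Icc (0 : ℝ) 1, ‖z t - y t‖ ≤ C / ω := by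
  have hbc := hKbar.continuous
  set D : ℝ := P * ((B + B) + (K + K) * B * 1) with hD
  have hD0 : 0 ≤ D := by positivity
  refine ⟨D + K * D * Real.exp (K + 1) + 1, by positivity, ?_⟩
  intro ω hω p y z h0 hy hz t ht
  -- `y` is controlled on `[0, 1]` only; freezing it outside gives a globally Lipschitz curve.
  set Y : ℝ → E := fun t => y (Set.projIcc 0 1 zero_le_one t) with hY
  have hYy : ∀ t ∈ Set.Icc (0 : ℝ) 1, Y t = y t := fun t ht => by
    simp only [hY]; rw [Set.projIcc_of_mem zero_le_one ht]
  have hyLip : LipschitzOnWith B y (Set.Icc 0 1) :=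
    (convex_Icc 0 1).lipschitzOnWith_of_nnnorm_hasDerivWithin_le hy fun t _ => hBbar (y t)
  have hYLip : LipschitzWith B Y := by
    refine LipschitzWith.of_dist_le_mul fun s t => ?_
    refine (hyLip.dist_le_mul _ (Subtype.coe_prop _) _ (Subtype.coe_prop _)).trans ?_
    gcongr
    simpa [Subtype.dist_eq] using
      (LipschitzWith.projIcc (zero_le_one (α := ℝ))).dist_le_mul s t
  have hYc := hYLip.continuous
  set g : E → ℝ → E := fun x s => h x (p + ω * s) - hbar x with hg
  have hgc : Continuous (Function.uncurry g) := by
    simp only [hg]; unfold Function.uncurry; fun_prop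
  have hgY : Continuous fun s => g (Y s) s := by fun_prop
  set b : ℝ → E := fun t => ∫ s in (0)..t, g (Y s) s with hb
  have hbD : ∀ t ∈ Set.Icc (0 : ℝ) 1, ‖b t‖ ≤ D / ω := by
    intro t ht
    have h1 := norm_integral_oscillating_le (K := K + K) (B := B + B) hgc
      (fun φ => (hK _).sub hKbar)
      (fun x φ => (norm_sub_le _ _).trans (add_le_add (hB _ _) (hBbar _)))
      (div_pos hP hω) (fun x s => ?_) hYLip ht.1
    · refine h1.trans ?_
      rw [hD, mul_div_right_comm]
      push_cast
      gcongr
      exact ht.2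
    · have h2 := integral_comp_add_mul (fun φ => h x φ - hbar x) hω.ne' p (a := s)
        (b := s + P / ω)
      simp only [hg]
      rw [h2, show p + ω * (s + P / ω) = (p + ω * s) + P by field_simp; ring, hmean, smul_zero]
  have hbderiv : ∀ t, HasDerivAt b (g (Y t) t) t := fun t =>
    integral_hasDerivAt_right (hgY.intervalIntegrable _ _)
      hgY.stronglyMeasurable.stronglyMeasurableAtFilter hgY.continuousAt
  have hbcont : Continuous b := continuous_iff_continuousAt.2 fun t => (hbderiv t).continuousAt
  -- The corrected curve `y + b` has derivative `h (y t) (p + ω * t)`, so it solves the fast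
  -- equation up to `K * ‖b‖ ≤ K * (D / ω)`, and Grönwall compares it with `z`. The constant `K + 1`
  -- replaces `K` to be nonzero in the Grönwall formula.
  have hgr := dist_le_of_approx_trajectories_ODE (v := fun t x => h x (p + ω * t)) (K := K + 1)
    (a := 0) (b := 1) (f := fun t => y t + b t) (f' := fun t => h (y t) (p + ω * t)) (g := z)
    (g' := fun t => h (z t) (p + ω * t)) (εf := K * (D / ω)) (εg := 0) (δ := 0)
    (fun t => (hK _).weaken (by simp)) (hy.continuousOn.add hbcont.continuousOn) ?_ ?_
    hz.continuousOn (fun _ ht => hz.hasDerivWithinAt_Ici ht) (by simp) (by simp [hb, h0]) t ht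
  · have h1 : gronwallBound 0 ((K + 1 : ℝ≥0) : ℝ) (K * (D / ω) + 0) (t - 0)
        ≤ K * (D / ω) * Real.exp (K + 1) := by
      have hK1 : ((K + 1 : ℝ≥0) : ℝ) ≠ 0 := by positivity
      rw [gronwallBound_of_K_ne_0 hK1]
      push_cast
      have h2 : Real.exp (((K : ℝ) + 1) * (t - 0)) ≤ Real.exp (K + 1) :=
        Real.exp_le_exp.2 (by nlinarith [ht.2, K.2])
      have h3 : (K * (D / ω) + 0) / ((K : ℝ) + 1) ≤ K * (D / ω) := by
        rw [add_zero]
        exact div_le_self (by positivity) (by linarith [K.2])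
      have h4 : 0 ≤ Real.exp (((K : ℝ) + 1) * (t - 0)) - 1 :=
        sub_nonneg.2 (Real.one_le_exp (mul_nonneg (by positivity) (by linarith [ht.1])))
      rw [zero_mul, zero_add]
      exact mul_le_mul h3 (by linarith) h4 (by positivity)
    rw [dist_comm, dist_eq_norm] at hgr
    have h5 : z t - y t = (z t - (y t + b t)) + b t := by abel
    rw [h5]
    calc _ ≤ _ := norm_add_le _ _
      _ ≤ K * (D / ω) * Real.exp (K + 1) + D / ω := add_le_add (hgr.trans h1) (hbD t ht)
      _ = (D + K * D * Real.exp (K + 1)) / ω := by ring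
      _ ≤ _ := div_le_div_of_nonneg_right (by linarith) hω.le
  · intro t ht
    have h1 := (hy.hasDerivWithinAt_Ici ht).add (hbderiv t).hasDerivWithinAt
    rw [hYy t ⟨ht.1, ht.2.le⟩] at h1
    simpa [hg] using! h1
  · intro t ht
    refine ((hK _).dist_le_mul _ _).trans ?_
    gcongr
    rw [dist_self_add_right]
    exact hbD t ⟨ht.1, ht.2.le⟩

end Averaging


/-! ### A single coupling along the rotating direction and its mean -/

theorem norm_le_sum_norm_apply {m : ℕ} (x : ArrayState m) : ‖x‖ ≤ ∑ i, ‖x i‖ := by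
  rw [PiLp.norm_eq_of_L2]
  refine Real.sqrt_le_iff.2 ⟨by positivity,
    Finset.sum_sq_le_sq_sum_of_nonneg fun i _ => norm_nonneg _⟩

theorem norm_dir (φ : ℝ) : ‖dir φ‖ = 1 := by
  simp [dir, EuclideanSpace.norm_eq]

theorem continuous_dir : Continuous dir := by
  unfold dir
  fun_prop

theorem abs_inner_dir_le (φ : ℝ) (v : Plane) : |inner ℝ (dir φ) v| ≤ ‖v‖ := by
  simpa [norm_dir] using abs_real_inner_le_norm (dir φ) v

/-- A scalar coupling function: bounded, Lipschitz, with the sign of its argument. -/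
structure ScalarCoupling (f : ℝ → ℝ) (L M : ℝ≥0) : Prop where
  lipschitz : LipschitzWith L f
  abs_le : ∀ s, |f s| ≤ M
  map_zero : f 0 = 0
  mul_nonneg : ∀ s, 0 ≤ s * f s
  zero_or_pos : f = 0 ∨ ∀ s ≠ 0, 0 < s * f s

theorem ScalarCoupling.abs_le_mul {f : ℝ → ℝ} {L M : ℝ≥0} (hf : ScalarCoupling f L M) (s : ℝ) :
    |f s| ≤ L * |s| := by
  simpa [Real.dist_eq, hf.map_zero] using hf.lipschitz.dist_le_mul s 0

/-- The mean over one period of a coupling along the rotating direction. -/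
noncomputable def averagedCoupling (f : ℝ → ℝ) (v : Plane) : Plane :=
  (2 * Real.pi)⁻¹ • ∫ φ in (0)..2 * Real.pi, f (inner ℝ (dir φ) v) • dir φ

theorem exists_polar (v : Plane) :
    ∃ θ : ℝ, v = !₂[‖v‖ * Real.cos θ, ‖v‖ * Real.sin θ] := by
  have h : ‖(⟨v 0, v 1⟩ : ℂ)‖ = ‖v‖ := by
    rw [Complex.norm_def, EuclideanSpace.norm_eq, Complex.normSq_apply]
    simp [Fin.sum_univ_two, sq]
  refine ⟨Complex.arg ⟨v 0, v 1⟩, ?_⟩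
  ext i
  fin_cases i
  · simpa [h] using (Complex.norm_mul_cos_arg (⟨v 0, v 1⟩ : ℂ)).symm
  · simpa [h] using (Complex.norm_mul_sin_arg (⟨v 0, v 1⟩ : ℂ)).symm

-- The reflection `ψ ↦ π - ψ` preserves `sin` and reverses the sign of `cos`. This removes the
-- component of the mean perpendicular to `v`.
open intervalIntegral Real in
theorem integral_comp_sin_mul_cos_eq_zero {f : ℝ → ℝ} (ρ : ℝ) :
    ∫ ψ in (0)..2 * π, f (ρ * sin ψ) * cos ψ = 0 := by
  have hper : Function.Periodic (fun ψ => f (ρ * sin ψ) * cos ψ) (2 * π) := fun ψ => by simp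
  have h1 := integral_comp_sub_left (fun ψ => f (ρ * sin ψ) * cos ψ) π (a := 0) (b := 2 * π)
  have h2 := hper.intervalIntegral_add_eq (π - 2 * π) 0
  simp only [sin_pi_sub, cos_pi_sub, mul_neg, integral_neg, sub_zero, sub_add_cancel,
    zero_add] at h1 h2
  linarith

open intervalIntegral Real in
/-- The averaged coupling acts along its argument, like a spring. -/
theorem exists_averagedCoupling_eq_smul {f : ℝ → ℝ} {L M : ℝ≥0} (hf : ScalarCoupling f L M)
    (v : Plane) : ∃ κ : ℝ, 0 ≤ κ ∧ κ ≤ L ∧ averagedCoupling f v = κ • v ∧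
      (f ≠ 0 → v ≠ 0 → 0 < κ) := by
  rcases eq_or_ne v 0 with rfl | hv
  · exact ⟨0, le_rfl, L.2, by simp [averagedCoupling, hf.map_zero], by simp⟩
  obtain ⟨θ, hθ⟩ := exists_polar v
  have hρ : 0 < ‖v‖ := norm_pos_iff.2 hv
  set ρ := ‖v‖
  have hfc := hf.lipschitz.continuous
  have hdc := continuous_dir
  set a : Plane := !₂[cos θ, sin θ] with ha
  set a' : Plane := !₂[-sin θ, cos θ] with ha'
  have hva : v = ρ • a := by rw [hθ]; ext i; fin_cases i <;> simp [ha]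
  set I : ℝ := ∫ ψ in (0)..2 * π, f (ρ * sin ψ) * sin ψ with hI
  -- With `φ = θ - ψ`, the direction is expressed in the orthonormal frame of `v`, and its inner
  -- product with `v` is `ρ * sin ψ`.
  have hdir : ∀ ψ, dir (θ - ψ) = sin ψ • a + cos ψ • a' := by
    intro ψ
    ext i
    fin_cases i
    · simp [dir, ha, ha', sin_sub]; ring
    · simp [dir, ha, ha', cos_sub]; ring
  have hinner : ∀ φ, inner ℝ (dir φ) v = ρ * sin (θ - φ) := by
    intro φ
    rw [hθ]
    simp [dir, PiLp.inner_apply, Fin.sum_univ_two, sin_sub]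
    ring
  have hint : ∫ φ in (0)..2 * π, f (inner ℝ (dir φ) v) • dir φ = I • a := by
    have h1 := integral_comp_sub_left (fun ψ => f (ρ * sin ψ) • dir (θ - ψ)) θ
      (a := 0) (b := 2 * π)
    have hper : Function.Periodic (fun ψ => f (ρ * sin ψ) • dir (θ - ψ)) (2 * π) := fun ψ => by
      simp only [hdir, sin_add_two_pi, cos_add_two_pi]
    have h2 := hper.intervalIntegral_add_eq (θ - 2 * π) 0
    simp only [sub_sub_cancel, sub_zero, sub_add_cancel, zero_add, ← hinner] at h1 h2
    rw [h1, h2]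
    simp only [hdir, smul_add, smul_smul]
    rw [integral_add, intervalIntegral.integral_smul_const, intervalIntegral.integral_smul_const,
      integral_comp_sin_mul_cos_eq_zero, zero_smul, add_zero]
    · exact Continuous.intervalIntegrable (by fun_prop) _ _
    · exact Continuous.intervalIntegrable (by fun_prop) _ _
  have hcI : Continuous fun ψ => f (ρ * sin ψ) * sin ψ := by fun_prop
  have hnn : ∀ ψ, 0 ≤ f (ρ * sin ψ) * sin ψ := fun ψ => by
    have := hf.mul_nonneg (ρ * sin ψ)
    rw [mul_assoc] at this
    linarith [nonneg_of_mul_nonneg_right this hρ]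
  have hI0 : 0 ≤ I := integral_nonneg (by positivity) fun ψ _ => hnn ψ
  have hIle : I ≤ L * ρ * (2 * π) := by
    have h1 := norm_integral_le_of_norm_le_const (a := 0) (b := 2 * π)
      (f := fun ψ => f (ρ * sin ψ) * sin ψ) (C := L * ρ) fun ψ _ => ?_
    · rw [sub_zero, abs_of_pos (by positivity : 0 < 2 * π)] at h1
      exact (le_abs_self _).trans h1
    · rw [norm_eq_abs, abs_mul]
      have h2 := hf.abs_le_mul (ρ * sin ψ)
      rw [abs_mul, abs_of_pos hρ] at h2
      calc _ ≤ (L * (ρ * |sin ψ|)) * |sin ψ| := by gcongr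
        _ ≤ (L * (ρ * 1)) * 1 := by gcongr <;> exact abs_sin_le_one ψ
        _ = _ := by ring
  refine ⟨(2 * π)⁻¹ * I * ρ⁻¹, by positivity, ?_, ?_, ?_⟩
  · rw [← div_eq_mul_inv, div_le_iff₀ hρ, inv_mul_le_iff₀ (by positivity)]
    linarith
  · rw [averagedCoupling, hint, hva, smul_smul, smul_smul]
    congr 1
    field_simp
  · intro hf0 _
    have hpos := hf.zero_or_pos.resolve_left hf0
    have : 0 < I := by
      refine integral_pos (by positivity) hcI.continuousOn (fun ψ _ => hnn ψ)
        ⟨π / 2, ⟨by positivity, by linarith [pi_pos]⟩, ?_⟩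
      have := hpos ρ hρ.ne'
      simpa using pos_of_mul_pos_right this hρ.le
    positivity

/-! ### Bounds and mean of the whole array -/

/-- A coupling all of whose entries are bounded and globally Lipschitz, without self-coupling. -/
structure BoundedCoupling {m : ℕ} (g : Fin m → Fin m → ℝ → ℝ) (L M : ℝ≥0) : Prop where
  scalar : ∀ i j, ScalarCoupling (g i j) L M
  diag : ∀ i, g i i = 0

/-- The mean of the rotated array over one period. -/
noncomputable def averagedArray {m : ℕ} (g : Fin m → Fin m → ℝ → ℝ) (x : ArrayState m) :
    ArrayState m :=
  (2 * Real.pi)⁻¹ • ∫ φ in (0)..2 * Real.pi, rotatedArray g x φ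

namespace BoundedCoupling

variable {m : ℕ} {g : Fin m → Fin m → ℝ → ℝ} {L M : ℝ≥0}

theorem rotatedArray_apply (hg : BoundedCoupling g L M) (x : ArrayState m) (φ : ℝ) (i : Fin m) :
    rotatedArray g x φ i = ∑ j, g i j (inner ℝ (dir φ) (x j - x i)) • dir φ := by
  rw [← Finset.sum_erase Finset.univ (a := i) (by simp [hg.diag])]
  rfl

theorem continuous_rotatedArray (hg : BoundedCoupling g L M) :
    Continuous (Function.uncurry (rotatedArray g)) := by
  have h1 := continuous_dir
  have h2 : ∀ i j, Continuous (g i j) := fun i j => (hg.scalar i j).lipschitz.continuous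
  refine (PiLp.continuous_toLp 2 _).comp (continuous_pi fun i => ?_)
  refine continuous_finsetSum _ fun j _ => ?_
  have h3 : Continuous fun a : ArrayState m × ℝ => inner ℝ (dir a.2) (a.1 j - a.1 i) := by
    fun_prop
  exact ((h2 i j).comp h3).smul (by fun_prop)

theorem norm_rotatedArray_le (hg : BoundedCoupling g L M) (x : ArrayState m) (φ : ℝ) :
    ‖rotatedArray g x φ‖ ≤ (m * m * M : ℝ≥0) := by
  calc _ ≤ ∑ i, ‖rotatedArray g x φ i‖ := norm_le_sum_norm_apply _
    _ ≤ ∑ i : Fin m, ∑ j : Fin m, (M : ℝ) := by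
      refine Finset.sum_le_sum fun i _ => ?_
      rw [hg.rotatedArray_apply]
      refine norm_sum_le_of_le _ fun j _ => ?_
      rw [norm_smul, norm_dir, mul_one]
      exact (hg.scalar i j).abs_le _
    _ = _ := by simp; ring

theorem lipschitzWith_rotatedArray (hg : BoundedCoupling g L M) (φ : ℝ) :
    LipschitzWith (m * m * (L * 2)) fun x => rotatedArray g x φ := by
  refine LipschitzWith.of_dist_le_mul fun x y => ?_
  rw [dist_eq_norm, dist_eq_norm]
  calc _ ≤ ∑ i, ‖(rotatedArray g x φ - rotatedArray g y φ) i‖ := norm_le_sum_norm_apply _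
    _ ≤ ∑ i : Fin m, ∑ j : Fin m, (L * (2 * ‖x - y‖) : ℝ) := by
      refine Finset.sum_le_sum fun i _ => ?_
      rw [PiLp.sub_apply, hg.rotatedArray_apply, hg.rotatedArray_apply, ← Finset.sum_sub_distrib]
      refine norm_sum_le_of_le _ fun j _ => ?_
      rw [← sub_smul, norm_smul, norm_dir, mul_one, ← dist_eq_norm]
      refine ((hg.scalar i j).lipschitz.dist_le_mul _ _).trans ?_
      gcongr
      rw [Real.dist_eq, ← inner_sub_right]
      refine (abs_inner_dir_le _ _).trans ?_
      have h : x j - x i - (y j - y i) = (x - y) j - (x - y) i := by simp; abel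
      rw [h]
      refine (norm_sub_le _ _).trans ?_
      linarith [PiLp.norm_apply_le (x - y) i, PiLp.norm_apply_le (x - y) j]
    _ = _ := by simp; ring

theorem continuous_rotatedArray_right (hg : BoundedCoupling g L M) (x : ArrayState m) :
    Continuous (rotatedArray g x) :=
  hg.continuous_rotatedArray.uncurry_left x

open Real

theorem norm_averagedArray_le (hg : BoundedCoupling g L M) (x : ArrayState m) :
    ‖averagedArray g x‖ ≤ (m * m * M : ℝ≥0) := by
  have h := intervalIntegral.norm_integral_le_of_norm_le_const (a := 0) (b := 2 * π)
    (f := rotatedArray g x) fun φ _ => hg.norm_rotatedArray_le x φ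
  have hp : 0 < 2 * π := by positivity
  rw [sub_zero, abs_of_pos hp] at h
  rw [averagedArray, norm_smul, norm_inv, norm_of_nonneg hp.le, inv_mul_le_iff₀ hp]
  linarith

theorem lipschitzWith_averagedArray (hg : BoundedCoupling g L M) :
    LipschitzWith (m * m * (L * 2)) (averagedArray g) := by
  refine LipschitzWith.of_dist_le_mul fun x y => ?_
  have h := intervalIntegral.norm_integral_le_of_norm_le_const (a := 0) (b := 2 * π)
    (f := fun φ => rotatedArray g x φ - rotatedArray g y φ)
    fun φ _ => dist_eq_norm (rotatedArray g x φ) _ ▸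
      (hg.lipschitzWith_rotatedArray φ).dist_le_mul x y
  have hp : 0 < 2 * π := by positivity
  rw [sub_zero, abs_of_pos hp, intervalIntegral.integral_sub
    ((hg.continuous_rotatedArray_right x).intervalIntegrable _ _)
    ((hg.continuous_rotatedArray_right y).intervalIntegrable _ _)] at h
  rw [dist_eq_norm, averagedArray, averagedArray, ← smul_sub, norm_smul, norm_inv,
    norm_of_nonneg hp.le, inv_mul_le_iff₀ hp]
  linarith

theorem integral_rotatedArray_sub_averagedArray (hg : BoundedCoupling g L M) (x : ArrayState m)
    (s : ℝ) : ∫ φ in s..s + 2 * π, (rotatedArray g x φ - averagedArray g x) = 0 := by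
  have hper : Function.Periodic (rotatedArray g x) (2 * π) := fun φ => by
    simp [rotatedArray, dir]
  have h := hper.intervalIntegral_add_eq s 0
  have hp : 2 * π ≠ 0 := by positivity
  have hc : IntervalIntegrable (fun _ : ℝ => averagedArray g x) MeasureTheory.volume s
      (s + 2 * π) := continuous_const.intervalIntegrable _ _
  rw [intervalIntegral.integral_sub
    ((hg.continuous_rotatedArray_right x).intervalIntegrable _ _) hc, h,
    intervalIntegral.integral_const, add_sub_cancel_left, averagedArray, smul_smul,
    mul_inv_cancel₀ hp, one_smul, zero_add, sub_self]

theorem averagedArray_apply (hg : BoundedCoupling g L M) (x : ArrayState m) (i : Fin m) :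
    averagedArray g x i = ∑ j, averagedCoupling (g i j) (x j - x i) := by
  have hr : IntervalIntegrable (rotatedArray g x) MeasureTheory.volume 0 (2 * π) :=
    (hg.continuous_rotatedArray_right x).intervalIntegrable _ _
  have h := (PiLp.proj 2 (𝕜 := ℝ) (fun _ : Fin m => Plane) i).intervalIntegral_comp_comm hr
  simp only [PiLp.proj_apply] at h
  rw [averagedArray, PiLp.smul_apply, ← h]
  simp only [hg.rotatedArray_apply, averagedCoupling]
  rw [intervalIntegral.integral_finsetSum, Finset.smul_sum]
  intro j _
  have h1 := continuous_dir
  have h2 := (hg.scalar i j).lipschitz.continuous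
  have h3 : Continuous fun φ : ℝ => inner ℝ (dir φ) (x j - x i) := by fun_prop
  exact Continuous.intervalIntegrable ((h2.comp h3).smul h1) _ _

end BoundedCoupling


section Consensus

/-! ### Scalar linear consensus with time-varying weights -/

/-- Squaring makes the positive part differentiable, so the excess over a bound can be fed into
Grönwall. -/
theorem hasDerivAt_max_zero_sq (s : ℝ) :
    HasDerivAt (fun s : ℝ => (max s 0) ^ 2) (2 * max s 0) s := by
  rcases lt_trichotomy s 0 with h | rfl | h
  · rw [max_eq_right h.le, mul_zero]
    refine (hasDerivAt_const s (0 : ℝ)).congr_of_eventuallyEq ?_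
    filter_upwards [Iio_mem_nhds h] with t ht
    simp [max_eq_right (show t ≤ 0 from le_of_lt ht)]
  · have h1 := hasDerivAt_id (0 : ℝ)
    rw [hasDerivAt_iff_isLittleO_nhds_zero]
    refine Asymptotics.IsBigO.trans_isLittleO (g := fun h : ℝ => h ^ 2) ?_ ?_
    · refine Asymptotics.IsBigO.of_bound 1 (Filter.Eventually.of_forall fun t => ?_)
      simp only [zero_add, max_self, ne_eq, OfNat.ofNat_ne_zero, not_false_eq_true, zero_pow,
        sub_zero, mul_zero, smul_zero, norm_pow, Real.norm_eq_abs, one_mul]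
      refine pow_le_pow_left₀ (abs_nonneg _) ?_ 2
      rw [abs_of_nonneg (le_max_right t 0)]
      exact max_le (le_abs_self t) (abs_nonneg t)
    · simpa using Asymptotics.isLittleO_pow_pow (𝕜 := ℝ) (m := 1) (n := 2) (by norm_num)
  · rw [max_eq_left h.le]
    refine HasDerivAt.congr_of_eventuallyEq (f := fun s => s ^ 2)
      (by simpa using hasDerivAt_pow 2 s) ?_
    filter_upwards [Ioi_mem_nhds h] with t ht
    rw [max_eq_left (le_of_lt ht)]

variable {m : ℕ} {w : Fin m → ℝ → ℝ} {a : ℝ → Fin m → Fin m → ℝ} {L c : ℝ}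

/-- The maximum principle for linear consensus. -/
theorem consensus_le (h0 : ∀ t i j, 0 ≤ a t i j) (hL : ∀ t i j, a t i j ≤ L)
    (hw : ∀ i, ∀ t ∈ Set.Icc (0 : ℝ) 1,
      HasDerivWithinAt (w i) (∑ j, a t i j * (w j t - w i t)) (Set.Icc 0 1) t)
    (hc : ∀ i, w i 0 ≤ c) : ∀ t ∈ Set.Icc (0 : ℝ) 1, ∀ i, w i t ≤ c := by
  set W : ℝ → ℝ := fun t => ∑ i, (max (w i t - c) 0) ^ 2 with hW
  set W' : ℝ → ℝ := fun t =>
    ∑ i, 2 * max (w i t - c) 0 * ∑ j, a t i j * (w j t - w i t) with hW'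
  have hd : ∀ t ∈ Set.Icc (0 : ℝ) 1, HasDerivWithinAt W (W' t) (Set.Icc 0 1) t := fun t ht =>
    HasDerivWithinAt.fun_sum fun i _ =>
      HasDerivAt.comp_hasDerivWithinAt (h₂ := fun s : ℝ => (max s 0) ^ 2) t
        (hasDerivAt_max_zero_sq (w i t - c)) ((hw i t ht).sub_const c)
  have hbound : ∀ t, W' t ≤ (2 * m * L) * W t + 0 := by
    intro t
    set p : Fin m → ℝ := fun i => max (w i t - c) 0 with hp
    have hp0 : ∀ i, 0 ≤ p i := fun i => le_max_right _ _
    -- Where `p i > 0` one has `w j - w i ≤ p j`, so only products `p i * p j` remain, and `2 * p i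
    -- * p j ≤ p i ^ 2 + p j ^ 2`.
    have hterm : ∀ i, 2 * p i * ∑ j, a t i j * (w j t - w i t) ≤ ∑ j, L * (p i ^ 2 + p j ^ 2) := by
      intro i
      rw [Finset.mul_sum]
      refine Finset.sum_le_sum fun j _ => ?_
      have h1 : p i * (w j t - w i t) ≤ p i * p j := by
        rcases le_total (w i t - c) 0 with h | h
        · simp [hp, max_eq_right h]
        · refine mul_le_mul_of_nonneg_left ?_ (hp0 i)
          linarith [le_max_left (w j t - c) 0]
      have h2 : a t i j * (p i * (w j t - w i t)) ≤ L * (p i * p j) :=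
        (mul_le_mul_of_nonneg_left h1 (h0 t i j)).trans
          (mul_le_mul_of_nonneg_right (hL t i j) (mul_nonneg (hp0 i) (hp0 j)))
      have hL0 : 0 ≤ L := (h0 t i j).trans (hL t i j)
      nlinarith [mul_nonneg hL0 (sq_nonneg (p i - p j))]
    calc W' t ≤ ∑ i, ∑ j, L * (p i ^ 2 + p j ^ 2) := Finset.sum_le_sum fun i _ => hterm i
      _ = (2 * m * L) * W t + 0 := by
        simp only [mul_add, Finset.sum_add_distrib, ← Finset.mul_sum, Finset.sum_const,
          Finset.card_univ, Fintype.card_fin, nsmul_eq_mul, hW, hp]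
        ring
  have hgr := le_gronwallBound_of_liminf_deriv_right_le (f := W) (f' := W') (δ := 0)
    (K := 2 * m * L) (ε := 0) (a := 0) (b := 1)
    (fun t ht => (hd t ht).continuousWithinAt)
    (fun t ht r hr => HasDerivWithinAt.liminf_right_slope_le
      (((hd t ⟨ht.1, ht.2.le⟩).mono_of_mem_nhdsWithin
        (Filter.mem_of_superset (Icc_mem_nhdsGE ht.2) (Set.Icc_subset_Icc_left ht.1)))) hr)
    (by simp [hW, hc]) (fun t _ => hbound t)
  intro t ht i
  have h1 := hgr t ht
  rw [gronwallBound_ε0_δ0] at h1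
  have h2 : (max (w i t - c) 0) ^ 2 ≤ W t :=
    Finset.single_le_sum (f := fun i => (max (w i t - c) 0) ^ 2)
      (fun _ _ => sq_nonneg _) (Finset.mem_univ i)
  have h3 : max (w i t - c) 0 = 0 := pow_eq_zero_iff two_ne_zero |>.1
    (le_antisymm (h2.trans h1) (sq_nonneg _))
  linarith [le_max_left (w i t - c) 0]

/-- An agent that is at the upper bound at the final time has always been there. -/
theorem consensus_eq_of_eq_right (h0 : ∀ t i j, 0 ≤ a t i j) (hL : ∀ t i j, a t i j ≤ L)
    (hw : ∀ i, ∀ t ∈ Set.Icc (0 : ℝ) 1,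
      HasDerivWithinAt (w i) (∑ j, a t i j * (w j t - w i t)) (Set.Icc 0 1) t)
    (hc : ∀ t ∈ Set.Icc (0 : ℝ) 1, ∀ i, w i t ≤ c) {i : Fin m} (hi : w i 1 = c) :
    ∀ t ∈ Set.Icc (0 : ℝ) 1, w i t = c := by
  have hd : ∀ t ∈ Set.Icc (0 : ℝ) 1, HasDerivWithinAt
      (fun t => (c - w i t) * Real.exp (m * L * t))
      ((-∑ j, a t i j * (w j t - w i t)) * Real.exp (m * L * t) +
        (c - w i t) * (Real.exp (m * L * t) * (m * L))) (Set.Icc 0 1) t := fun t ht =>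
    ((hw i t ht).const_sub c).mul
      (by simpa using (((hasDerivAt_id t).const_mul (m * L)).exp).hasDerivWithinAt)
  -- All agents are below `c`, so the gap `c - w i` decays at rate at most `m * L`; with this
  -- integrating factor it is monotone, and it vanishes at the end.
  have hmono : MonotoneOn (fun t => (c - w i t) * Real.exp (m * L * t)) (Set.Icc 0 1) := by
    refine monotoneOn_of_hasDerivWithinAt_nonneg (convex_Icc 0 1)
      (fun t ht => (hd t ht).continuousWithinAt)
      (fun t ht => (hd t (interior_subset ht)).mono interior_subset) fun t ht => ?_
    have ht := interior_subset ht
    have h1 : ∑ j, a t i j * (w j t - w i t) ≤ m * L * (c - w i t) := by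
      calc _ ≤ ∑ j : Fin m, L * (c - w i t) := Finset.sum_le_sum fun j _ =>
            (mul_le_mul_of_nonneg_left (by linarith [hc t ht j]) (h0 t i j)).trans
              (mul_le_mul_of_nonneg_right (hL t i j) (by linarith [hc t ht i]))
        _ = _ := by simp; ring
    nlinarith [mul_nonneg (sub_nonneg.2 h1) (Real.exp_pos (m * L * t)).le]
  intro t ht
  have h1 := hmono ht ⟨zero_le_one, le_rfl⟩ ht.2
  simp only [hi, sub_self, zero_mul] at h1
  have h2 : c - w i t ≤ 0 := nonpos_of_mul_nonpos_left h1 (Real.exp_pos _)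
  exact le_antisymm (hc t ht i) (by linarith)

/-- If an agent stays at the upper bound, so do those that it listens to. -/
theorem consensus_neighbor (h0 : ∀ t i j, 0 ≤ a t i j)
    (hw : ∀ i, ∀ t ∈ Set.Icc (0 : ℝ) 1,
      HasDerivWithinAt (w i) (∑ j, a t i j * (w j t - w i t)) (Set.Icc 0 1) t)
    (hc : ∀ t ∈ Set.Icc (0 : ℝ) 1, ∀ i, w i t ≤ c) {i : Fin m}
    (hi : ∀ t ∈ Set.Ioo (0 : ℝ) 1, w i t = c) (j : Fin m) {t : ℝ} (ht : t ∈ Set.Ioo (0 : ℝ) 1) :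
    a t i j = 0 ∨ w j t = c := by
  have ht' := Set.Ioo_subset_Icc_self ht
  have h1 := (hw i t ht').hasDerivAt (Icc_mem_nhds ht.1 ht.2)
  have h2 : HasDerivAt (w i) 0 t := by
    refine (hasDerivAt_const t c).congr_of_eventuallyEq ?_
    filter_upwards [Ioo_mem_nhds ht.1 ht.2] with s hs using hi s hs
  have h3 := h1.unique h2
  -- At the upper bound every summand is nonpositive, and the sum is the derivative of a constant.
  rw [Finset.sum_eq_zero_iff_of_nonpos] at h3
  · rcases mul_eq_zero.1 (h3 j (Finset.mem_univ j)) with h | h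
    · exact Or.inl h
    · exact Or.inr (by linarith [hi t ht])
  · intro k _
    exact mul_nonpos_of_nonneg_of_nonpos (h0 t i k) (by linarith [hi t ht, hc t ht' k])

end Consensus

/-! ### The disagreement and the distance to the synchronization manifold -/

section Disagreement

variable {m : ℕ}

/-- The largest distance between two blocks of a state. -/
noncomputable def disagreement (x : ArrayState m) : ℝ :=
  ‖fun p : Fin m × Fin m => x p.1 - x p.2‖

theorem norm_sub_le_disagreement (x : ArrayState m) (i j : Fin m) :
    ‖x i - x j‖ ≤ disagreement x :=
  norm_le_pi_norm (fun p : Fin m × Fin m => x p.1 - x p.2) (i, j)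

theorem disagreement_le {x : ArrayState m} {c : ℝ} (hc : 0 ≤ c) (h : ∀ i j, ‖x i - x j‖ ≤ c) :
    disagreement x ≤ c :=
  (pi_norm_le_iff_of_nonneg hc).2 fun p => h p.1 p.2

theorem disagreement_nonneg (x : ArrayState m) : 0 ≤ disagreement x :=
  norm_nonneg _

theorem continuous_disagreement : Continuous (disagreement (m := m)) := by
  unfold disagreement
  fun_prop

theorem disagreement_le_add (x y : ArrayState m) :
    disagreement x ≤ disagreement y + 2 * ‖x - y‖ := by
  have := disagreement_nonneg y
  refine disagreement_le (by positivity) fun i j => ?_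
  have h : x i - x j = (y i - y j) + ((x - y) i - (x - y) j) := by
    simp only [PiLp.sub_apply]; abel
  rw [h]
  refine (norm_add_le _ _).trans (add_le_add (norm_sub_le_disagreement y i j) ?_)
  refine (norm_sub_le _ _).trans ?_
  linarith [PiLp.norm_apply_le (x - y) i, PiLp.norm_apply_le (x - y) j]

theorem exists_norm_sub_eq_disagreement [Nonempty (Fin m)] (x : ArrayState m) :
    ∃ i j, ‖x i - x j‖ = disagreement x := by
  obtain ⟨p, hp⟩ := Finite.exists_max fun p : Fin m × Fin m => ‖x p.1 - x p.2‖
  exact ⟨p.1, p.2, le_antisymm (norm_sub_le_disagreement x _ _)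
    (disagreement_le (norm_nonneg _) fun i j => hp (i, j))⟩

/-- The state all of whose blocks are equal to `v`. -/
def constState (m : ℕ) (v : Plane) : ArrayState m := WithLp.toLp 2 fun _ => v

@[simp] theorem constState_apply (v : Plane) (i : Fin m) : constState m v i = v := rfl

theorem disagreement_sub_constState (x : ArrayState m) (v : Plane) :
    disagreement (x - constState m v) = disagreement x := by
  simp [disagreement]

theorem norm_sub_constState_le (x : ArrayState m) (i : Fin m) :
    ‖x - constState m (x i)‖ ≤ m * disagreement x := by
  refine (norm_le_sum_norm_apply _).trans ?_
  calc _ ≤ ∑ _ : Fin m, disagreement x :=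
        Finset.sum_le_sum fun j _ => norm_sub_le_disagreement x j i
    _ = _ := by simp

theorem constState_mem_syncManifold (v : Plane) : constState m v ∈ syncManifold m :=
  fun _ _ => rfl

theorem infDist_syncManifold_le (hm : 0 < m) (x : ArrayState m) :
    Metric.infDist x (syncManifold m) ≤ m * disagreement x :=
  (Metric.infDist_le_dist_of_mem (constState_mem_syncManifold (x ⟨0, hm⟩))).trans
    (dist_eq_norm x _ ▸ norm_sub_constState_le x ⟨0, hm⟩)

theorem disagreement_le_infDist (x : ArrayState m) :
    disagreement x ≤ 2 * Metric.infDist x (syncManifold m) := by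
  rw [← div_le_iff₀' two_pos]
  refine (Metric.le_infDist ⟨constState m 0, constState_mem_syncManifold 0⟩).2 fun y hy => ?_
  have h := disagreement_le_add x y
  have h2 : disagreement y = 0 :=
    le_antisymm (disagreement_le le_rfl fun i j => by simp [hy i j]) (disagreement_nonneg y)
  rw [dist_eq_norm]
  linarith

theorem isClosed_syncManifold : IsClosed (syncManifold m) := by
  have h : syncManifold m = ⋂ i, ⋂ j, {x : ArrayState m | x i = x j} := by
    ext x; simp [syncManifold]
  rw [h]
  exact isClosed_iInter fun i => isClosed_iInter fun j =>
    isClosed_eq (by fun_prop) (by fun_prop)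

theorem averagedArray_sub_constState (g : Fin m → Fin m → ℝ → ℝ) (x : ArrayState m) (v : Plane) :
    averagedArray g (x - constState m v) = averagedArray g x := by
  simp [averagedArray, rotatedArray]

end Disagreement

/-! ### Decrease of the disagreement for the averaged array -/

namespace BoundedCoupling

variable {m : ℕ} {g : Fin m → Fin m → ℝ → ℝ} {L M : ℝ≥0}

/-- The spring factors `κ`, evaluated along the given solution, serve as time-varying weights. They
do not depend on `u`, so the nonlinear array becomes linear consensus in every direction at once. -/
theorem exists_weights (hg : BoundedCoupling g L M) {y : ℝ → ArrayState m}
    (hy : IsSolutionOn (fun _ => averagedArray g) (Set.Icc 0 1) y) :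
    ∃ a : ℝ → Fin m → Fin m → ℝ, (∀ t i j, 0 ≤ a t i j) ∧ (∀ t i j, a t i j ≤ L) ∧
      (∀ t i j, g i j ≠ 0 → y t j ≠ y t i → 0 < a t i j) ∧
      ∀ (u : Plane) (i : Fin m), ∀ t ∈ Set.Icc (0 : ℝ) 1,
        HasDerivWithinAt (fun t => inner ℝ u (y t i))
          (∑ j, a t i j * (inner ℝ u (y t j) - inner ℝ u (y t i))) (Set.Icc 0 1) t := by
  choose κ hκ0 hκL hκ hκpos using fun i j => exists_averagedCoupling_eq_smul (hg.scalar i j)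
  refine ⟨fun t i j => κ i j (y t j - y t i), fun _ _ _ => hκ0 _ _ _, fun _ _ _ => hκL _ _ _,
    fun t i j hij hne => hκpos i j _ hij (sub_ne_zero.2 hne), fun u i t ht => ?_⟩
  have h1 := (PiLp.proj 2 (𝕜 := ℝ) (fun _ : Fin m => Plane) i).hasFDerivAt.comp_hasDerivWithinAt t
    (hy t ht)
  have h2 := (innerSL ℝ u).hasFDerivAt.comp_hasDerivWithinAt t h1
  simp only [PiLp.proj_apply, hg.averagedArray_apply, hκ, innerSL_apply_apply, inner_sum,
    inner_smul_right, inner_sub_right] at h2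
  exact h2

/-- The averaged array satisfies the maximum principle in every direction. -/
theorem averaged_inner_le (hg : BoundedCoupling g L M) {y : ℝ → ArrayState m}
    (hy : IsSolutionOn (fun _ => averagedArray g) (Set.Icc 0 1) y) {u : Plane} {c : ℝ}
    (hc : ∀ i, inner ℝ u (y 0 i) ≤ c) : ∀ t ∈ Set.Icc (0 : ℝ) 1, ∀ i, inner ℝ u (y t i) ≤ c := by
  obtain ⟨a, h0, hL, -, hd⟩ := hg.exists_weights hy
  exact consensus_le h0 hL (hd u) hc

/-- If some block of the averaged array ends at the initial upper bound in the direction `u`, then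
the root of the graph attains this bound. -/
theorem averaged_root_eq (hg : BoundedCoupling g L M) {r : Fin m}
    (hr : ∀ v, v ≠ r → Relation.ReflTransGen (couplingGraph g).Adj v r) {y : ℝ → ArrayState m}
    (hy : IsSolutionOn (fun _ => averagedArray g) (Set.Icc 0 1) y) {u : Plane} {c : ℝ}
    (hc : ∀ i, inner ℝ u (y 0 i) ≤ c) {i : Fin m} (hi : inner ℝ u (y 1 i) = c) {t : ℝ}
    (ht : t ∈ Set.Ioo (0 : ℝ) 1) : inner ℝ u (y t r) = c := by
  have hle := hg.averaged_inner_le hy hc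
  obtain ⟨a, h0, hL, hpos, hd⟩ := hg.exists_weights hy
  have hstart : ∀ t ∈ Set.Ioo (0 : ℝ) 1, inner ℝ u (y t i) = c := fun t ht =>
    consensus_eq_of_eq_right h0 hL (hd u) hle hi t (Set.Ioo_subset_Icc_self ht)
  have hpath : Relation.ReflTransGen (couplingGraph g).Adj i r := by
    by_cases h : i = r
    · rw [h]
    · exact hr i h
  suffices h : ∀ t ∈ Set.Ioo (0 : ℝ) 1, inner ℝ u (y t r) = c from h t ht
  clear hr
  induction hpath with
  | refl => exact hstart
  | @tail j k _ hjk ih =>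
    intro t ht
    rcases consensus_neighbor h0 (hd u) hle ih k ht with h | h
    -- A vanishing weight on an edge means that the two blocks coincide, so the extremal value
    -- passes on in this case too.
    · by_cases hjk' : y t k = y t j
      · rw [hjk', ih t ht]
      · exact absurd h (hpos t j k hjk.2 hjk').ne'
    · exact h

/-- For a solution of the averaged array, every vector between two blocks is dominated by a vector
between two initial blocks. -/
theorem averaged_norm_sub_le (hg : BoundedCoupling g L M) {y : ℝ → ArrayState m}
    (hy : IsSolutionOn (fun _ => averagedArray g) (Set.Icc 0 1) y) {t : ℝ}
    (ht : t ∈ Set.Icc (0 : ℝ) 1) (i j : Fin m) : ‖y t i - y t j‖ ≤ disagreement (y 0) := by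
  have : Nonempty (Fin m) := ⟨i⟩
  set v := y t i - y t j with hv
  obtain ⟨k, hk⟩ := Finite.exists_max fun k => (inner ℝ v (y 0 k) : ℝ)
  obtain ⟨l, hl⟩ := Finite.exists_max fun k => (inner ℝ (-v) (y 0 k) : ℝ)
  have h1 := hg.averaged_inner_le hy hk t ht i
  have h2 := hg.averaged_inner_le hy hl t ht j
  simp only [inner_neg_left] at h2
  have h3 : ‖v‖ * ‖v‖ ≤ ‖v‖ * disagreement (y 0) := by
    calc ‖v‖ * ‖v‖ = inner ℝ v (y t i) - inner ℝ v (y t j) := by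
          rw [← inner_sub_right, ← hv, real_inner_self_eq_norm_mul_norm]
      _ ≤ inner ℝ v (y 0 k - y 0 l) := by rw [inner_sub_right]; linarith
      _ ≤ ‖v‖ * ‖y 0 k - y 0 l‖ := real_inner_le_norm _ _
      _ ≤ _ := by gcongr; exact norm_sub_le_disagreement _ _ _
  rcases (norm_nonneg v).eq_or_lt with h | h
  · rw [← h]; exact disagreement_nonneg _
  · exact le_of_mul_le_mul_left h3 h

theorem averaged_disagreement_le (hg : BoundedCoupling g L M) {y : ℝ → ArrayState m}
    (hy : IsSolutionOn (fun _ => averagedArray g) (Set.Icc 0 1) y) {t : ℝ}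
    (ht : t ∈ Set.Icc (0 : ℝ) 1) : disagreement (y t) ≤ disagreement (y 0) :=
  disagreement_le (disagreement_nonneg _) (hg.averaged_norm_sub_le hy ht)

/-- Take `v` to be a longest difference at time `1`. Without a decrease, its two ends lie at the
initial maximum and minimum in the direction `v`; the root then attains both, forcing `v = 0`. -/
theorem averaged_disagreement_lt (hg : BoundedCoupling g L M)
    (hconn : IsConnected (couplingGraph g)) {y : ℝ → ArrayState m}
    (hy : IsSolutionOn (fun _ => averagedArray g) (Set.Icc 0 1) y)
    (hpos : 0 < disagreement (y 0)) : disagreement (y 1) < disagreement (y 0) := by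
  by_contra! hge
  obtain ⟨r, hr⟩ := hconn
  have : Nonempty (Fin m) := ⟨r⟩
  obtain ⟨i, j, hij⟩ := exists_norm_sub_eq_disagreement (y 1)
  set v := y 1 i - y 1 j with hv
  obtain ⟨k, hk⟩ := Finite.exists_max fun k => (inner ℝ v (y 0 k) : ℝ)
  obtain ⟨l, hl⟩ := Finite.exists_max fun k => (inner ℝ (-v) (y 0 k) : ℝ)
  have h1 := hg.averaged_inner_le hy hk 1 ⟨zero_le_one, le_rfl⟩ i
  have h2 := hg.averaged_inner_le hy hl 1 ⟨zero_le_one, le_rfl⟩ j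
  have hvv : ‖v‖ * ‖v‖ = inner ℝ v (y 1 i) - inner ℝ v (y 1 j) := by
    rw [← inner_sub_right, ← hv, real_inner_self_eq_norm_mul_norm]
  have hkl : (inner ℝ v (y 0 k) - inner ℝ v (y 0 l) : ℝ) ≤ ‖v‖ * ‖v‖ := by
    rw [← inner_sub_right]
    refine (real_inner_le_norm _ _).trans ?_
    gcongr
    exact (norm_sub_le_disagreement _ _ _).trans (hge.trans hij.ge)
  simp only [inner_neg_left] at h2
  have h3 : inner ℝ v (y 1 i) = (inner ℝ v (y 0 k) : ℝ) := by linarith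
  have h4 : inner ℝ (-v) (y 1 j) = (inner ℝ (-v) (y 0 l) : ℝ) := by
    simp only [inner_neg_left]; linarith
  have ht : (1 / 2 : ℝ) ∈ Set.Ioo (0 : ℝ) 1 := by constructor <;> norm_num
  have h5 := hg.averaged_root_eq hr hy hk h3 ht
  have h6 := hg.averaged_root_eq hr hy hl h4 ht
  simp only [inner_neg_left] at h4 h6
  have h7 : ‖v‖ * ‖v‖ = 0 := by linarith
  have h8 : ‖v‖ = 0 := by simpa using h7
  linarith

/-- On bounded levels away from zero, the averaged array decreases the disagreement by a fixed amount
in one unit of time. -/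
theorem exists_averaged_decrease (hg : BoundedCoupling g L M)
    (hconn : IsConnected (couplingGraph g)) {d : ℝ} (hd : 0 < d) (R : ℝ) :
    ∃ c > (0 : ℝ), ∀ y : ℝ → ArrayState m,
      IsSolutionOn (fun _ => averagedArray g) (Set.Icc 0 1) y → d ≤ disagreement (y 0) →
      disagreement (y 0) ≤ R → disagreement (y 1) ≤ disagreement (y 0) - c := by
  obtain ⟨r, hr⟩ := id hconn
  have hLip := hg.lipschitzWith_averagedArray
  choose φ hφ0 hφ using fun x₀ => exists_isSolutionOn_Icc (f := fun _ => averagedArray g)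
    (fun _ => hLip) (fun _ => continuous_const) (fun _ => hg.norm_averagedArray_le) 0 1
    zero_le_one x₀
  simp only [zero_add] at hφ
  have hφc : Continuous fun x => φ x 1 := by
    refine LipschitzWith.continuous
      (K := ⟨Real.exp ((m * m * (L * 2) : ℝ≥0) * (1 - 0)), (Real.exp_pos _).le⟩)
      (LipschitzWith.of_dist_le_mul fun x x' => ?_)
    have h := dist_le_of_trajectories_ODE (v := fun _ => averagedArray g) (fun _ => hLip)
      (hφ x).continuousOn (fun _ ht => (hφ x).hasDerivWithinAt_Ici ht)
      (hφ x').continuousOn (fun _ ht => (hφ x').hasDerivWithinAt_Ici ht) le_rfl 1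
      ⟨zero_le_one, le_rfl⟩
    rw [hφ0, hφ0, mul_comm] at h
    exact h
  -- Translation invariance allows the root block to be placed at the origin, which makes the level
  -- set compact.
  set S : Set (ArrayState m) := {x | x r = 0 ∧ d ≤ disagreement x ∧ disagreement x ≤ R} with hS
  have hSc : IsCompact S := by
    refine Metric.isCompact_of_isClosed_isBounded ?_ ?_
    · exact (isClosed_eq (by fun_prop) continuous_const).inter
        ((isClosed_le continuous_const continuous_disagreement).inter
          (isClosed_le continuous_disagreement continuous_const))
    · refine (Metric.isBounded_closedBall (x := 0) (r := m * R)).subset fun x hx => ?_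
      have h := norm_sub_constState_le x r
      have h0 : constState m (x r) = 0 := by ext i; simp [hx.1]
      rw [h0, sub_zero] at h
      rw [mem_closedBall_zero_iff]
      exact h.trans (by gcongr; exact hx.2.2)
  have key : ∃ c > (0 : ℝ), ∀ x ∈ S, disagreement (φ x 1) ≤ disagreement x - c := by
    rcases S.eq_empty_or_nonempty with h | h
    · exact ⟨1, one_pos, by simp [h]⟩
    · obtain ⟨x, hxS, hx⟩ := hSc.exists_isMinOn h
        (f := fun x => disagreement x - disagreement (φ x 1))
        (continuous_disagreement.sub (continuous_disagreement.comp hφc)).continuousOn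
      refine ⟨disagreement x - disagreement (φ x 1), sub_pos.2 ?_,
        fun x' hx' => by linarith [isMinOn_iff.1 hx x' hx']⟩
      have h1 := hg.averaged_disagreement_lt hconn (hφ x)
      rw [hφ0] at h1
      exact h1 (hd.trans_le hxS.2.1)
  obtain ⟨c, hc, hkey⟩ := key
  refine ⟨c, hc, fun y hy hdy hyR => ?_⟩
  set k := constState m (y 0 r) with hk
  have hyk : IsSolutionOn (fun _ => averagedArray g) (Set.Icc 0 1) fun t => y t - k :=
    fun t ht => by
      simpa only [hk, averagedArray_sub_constState] using (hy t ht).sub_const k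
  have h1 := hkey (y 0 - k) ⟨by simp [hk], by rwa [disagreement_sub_constState],
    by rwa [disagreement_sub_constState]⟩
  have h2 := (hφ (y 0 - k)).eqOn (fun _ => hLip) hyk (hφ0 _)
    (⟨zero_le_one, le_rfl⟩ : (1 : ℝ) ∈ Set.Icc (0 : ℝ) 1)
  rwa [h2, disagreement_sub_constState, disagreement_sub_constState] at h1

end BoundedCoupling


/-! ### From the averaged decrease to practical bounds -/

variable {m : ℕ}

theorem BoundedCoupling.exists_practical_bounds {g : Fin m → Fin m → ℝ → ℝ} {L M : ℝ≥0}
    (hg : BoundedCoupling g L M) (hconn : IsConnected (couplingGraph g)) {R d : ℝ} (hd : 0 < d)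
    (hdR : d ≤ R) :
    ∃ ωstar > (0 : ℝ), ∀ ω ≥ ωstar, ∃ T > (0 : ℝ), ∀ (t₀ : ℝ) (z : ℝ → ArrayState m),
      IsSolutionOn (fun t x => rotatedArray g x (ω * t)) (Set.Ici t₀) z →
      (disagreement (z t₀) ≤ R → ∀ t ≥ t₀, disagreement (z t) ≤ 2 * R) ∧
      (disagreement (z t₀) ≤ d / 2 → ∀ t ≥ t₀, disagreement (z t) ≤ d) ∧
      (disagreement (z t₀) ≤ R → ∀ t ≥ t₀ + T, disagreement (z t) ≤ d) := by
  obtain ⟨c, hc, hdec⟩ := hg.exists_averaged_decrease hconn (d := d / 4) (by positivity) R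
  have hLip := hg.lipschitzWith_averagedArray
  obtain ⟨C, hC, havg⟩ := exists_averaging_bound hg.continuous_rotatedArray
    hg.lipschitzWith_rotatedArray hg.norm_rotatedArray_le hLip hg.norm_averagedArray_le
    (by positivity : 0 < 2 * Real.pi) hg.integral_rotatedArray_sub_averagedArray
  -- An error of at most `c / 2` leaves half of the decrease; one of at most `d / 4` keeps a state
  -- of disagreement at most `d / 4` below `d / 2` for one unit of time.
  have hη : 0 < min (c / 2) (d / 4) := by positivity
  refine ⟨2 * C / min (c / 2) (d / 4), by positivity, fun ω hω => ?_⟩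
  have hω0 : 0 < ω := lt_of_lt_of_le (by positivity) hω
  have herr : 2 * (C / ω) ≤ min (c / 2) (d / 4) := by
    rw [← mul_div_assoc, div_le_iff₀ hω0, mul_comm (min _ _)]
    exact (div_le_iff₀ hη).1 hω
  have herr1 : 2 * (C / ω) ≤ c / 2 := herr.trans (min_le_left _ _)
  have herr2 : 2 * (C / ω) ≤ d / 4 := herr.trans (min_le_right _ _)
  obtain ⟨N, hN⟩ := exists_nat_gt (R / (c / 2))
  rw [div_lt_iff₀ (by positivity)] at hN
  refine ⟨N + 1, by positivity, fun t₀ z hz => ?_⟩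
  have hcompare : ∀ t ≥ t₀, ∃ y : ℝ → ArrayState m, y 0 = z t ∧
      IsSolutionOn (fun _ => averagedArray g) (Set.Icc 0 1) y ∧
      ∀ s ∈ Set.Icc (0 : ℝ) 1, disagreement (z (t + s)) ≤ disagreement (y s) + 2 * (C / ω) := by
    intro t ht
    obtain ⟨y, hy0, hy⟩ := exists_isSolutionOn_Icc (f := fun _ => averagedArray g)
      (fun _ => hLip) (fun _ => continuous_const) (fun _ => hg.norm_averagedArray_le) 0 1
      zero_le_one (z t)
    rw [zero_add] at hy
    refine ⟨y, hy0, hy, fun s hs => ?_⟩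
    have hz' : IsSolutionOn (fun s x => rotatedArray g x (ω * t + ω * s)) (Set.Icc 0 1)
        fun s => z (t + s) := by
      have := hz.comp_const_add (J := Set.Icc 0 1) t fun s hs =>
        le_trans ht (le_add_of_nonneg_right hs.1)
      simpa only [mul_add] using this
    have h := havg ω hω0 (ω * t) y (fun s => z (t + s)) (by simp [hy0]) hy hz' s hs
    exact (disagreement_le_add _ (y s)).trans (by gcongr)
  have hgrow : ∀ t ≥ t₀, ∀ s ∈ Set.Icc (0 : ℝ) 1,
      disagreement (z (t + s)) ≤ disagreement (z t) + d / 4 := by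
    intro t ht s hs
    obtain ⟨y, hy0, hy, h⟩ := hcompare t ht
    have h1 := hg.averaged_disagreement_le hy hs
    rw [hy0] at h1
    linarith [h s hs]
  have hdecr : ∀ t ≥ t₀, d / 4 ≤ disagreement (z t) → disagreement (z t) ≤ R →
      disagreement (z (t + 1)) ≤ disagreement (z t) - c / 2 := by
    intro t ht h1 h2
    obtain ⟨y, hy0, hy, h⟩ := hcompare t ht
    have h3 := hdec y hy (by rwa [hy0]) (by rwa [hy0])
    rw [hy0] at h3
    linarith [h 1 ⟨zero_le_one, le_rfl⟩]
  -- Above `d / 4` the disagreement decreases; below, it ends at most at `d / 4 + d / 4 ≤ b`.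
  have hstep : ∀ b, d / 2 ≤ b → b ≤ R → ∀ t ≥ t₀, disagreement (z t) ≤ b →
      disagreement (z (t + 1)) ≤ b := by
    intro b hdb hbR t ht h
    rcases le_total (d / 4) (disagreement (z t)) with h1 | h1
    · linarith [hdecr t ht h1 (h.trans hbR)]
    · linarith [hgrow t ht 1 ⟨zero_le_one, le_rfl⟩]
  have hinv : ∀ b, d / 2 ≤ b → b ≤ R → ∀ t' ≥ t₀, disagreement (z t') ≤ b →
      ∀ t ≥ t', disagreement (z t) ≤ b + d / 4 := by
    intro b hdb hbR t' ht' h t ht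
    have hn : ∀ n : ℕ, disagreement (z (t' + n)) ≤ b := by
      intro n
      induction n with
      | zero => simpa using h
      | succ n ih =>
        rw [Nat.cast_succ, ← add_assoc]
        exact hstep b hdb hbR _ (le_trans ht' (le_add_of_nonneg_right n.cast_nonneg)) ih
    have h1 := hgrow (t' + ⌊t - t'⌋₊) (le_trans ht' (le_add_of_nonneg_right (Nat.cast_nonneg _)))
      (t - (t' + ⌊t - t'⌋₊)) ⟨by linarith [Nat.floor_le (sub_nonneg.2 ht)],
        by linarith [Nat.lt_floor_add_one (t - t')]⟩
    rw [add_sub_cancel] at h1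
    linarith [hn ⌊t - t'⌋₊]
  refine ⟨fun h t ht => ?_, fun h t ht => ?_, fun h t ht => ?_⟩
  · linarith [hinv R (by linarith) le_rfl t₀ le_rfl h t ht]
  · linarith [hinv (d / 2) le_rfl (by linarith) t₀ le_rfl h t ht]
  -- Until the level `d / 2` is reached, each step loses `c / 2`; by the choice of `N` the second
  -- alternative is negative at `n = N`, hence impossible.
  · have hn : ∀ n : ℕ, (∃ k ≤ n, disagreement (z (t₀ + (k : ℕ))) ≤ d / 2) ∨
        disagreement (z (t₀ + n)) ≤ R - n * (c / 2) := by
      intro n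
      induction n with
      | zero => right; simpa using h
      | succ n ih =>
        rcases ih with ⟨k, hk, hkd⟩ | ih
        · exact Or.inl ⟨k, hk.trans n.le_succ, hkd⟩
        · rcases le_total (disagreement (z (t₀ + n))) (d / 2) with h1 | h1
          · exact Or.inl ⟨n, n.le_succ, h1⟩
          · right
            have h2 : 0 ≤ (n : ℝ) * (c / 2) := by positivity
            have h3 := hdecr (t₀ + n) (le_add_of_nonneg_right n.cast_nonneg) (by linarith)
              (by linarith)
            rw [Nat.cast_succ, ← add_assoc]
            linarith
    rcases hn N with ⟨k, hk, hkd⟩ | h1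
    · have hk' : (k : ℝ) ≤ N := by exact_mod_cast hk
      linarith [hinv (d / 2) le_rfl (by linarith) (t₀ + k)
        (le_add_of_nonneg_right k.cast_nonneg) hkd t (by linarith)]
    · linarith [disagreement_nonneg (z (t₀ + N))]

/-! ### Clamping the couplings -/

/-- The coupling obtained by evaluating at the argument clamped to `[-ρ, ρ]`. -/
noncomputable def clampedCoupling (γ : Fin m → Fin m → ℝ → ℝ) (ρ : ℝ) : Fin m → Fin m → ℝ → ℝ :=
  fun i j s => if i = j then 0 else γ i j (max (-ρ) (min s ρ))

theorem rotatedArray_clampedCoupling (γ : Fin m → Fin m → ℝ → ℝ) {ρ : ℝ} {x : ArrayState m}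
    (hx : disagreement x ≤ ρ) (φ : ℝ) :
    rotatedArray (clampedCoupling γ ρ) x φ = rotatedArray γ x φ := by
  refine PiLp.ext fun i => ?_
  change ∑ j ∈ Finset.univ.erase i, _ = ∑ j ∈ Finset.univ.erase i, _
  refine Finset.sum_congr rfl fun j hj => ?_
  have h := abs_le.1 (((abs_inner_dir_le φ (x j - x i)).trans
    (norm_sub_le_disagreement x j i)).trans hx)
  rw [clampedCoupling, if_neg (Finset.ne_of_mem_erase hj).symm, min_eq_left h.2, max_eq_right h.1]

theorem IsInterconnection.mul_pos {γ : Fin m → Fin m → ℝ → ℝ} (hγ : IsInterconnection γ)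
    {i j : Fin m} (hij : i ≠ j) (h : γ i j ≠ 0) {s : ℝ} (hs : s ≠ 0) : 0 < s * γ i j s := by
  obtain ⟨α, hα, hb⟩ := (hγ.zero_or_bound i j hij).resolve_left h
  have h1 : 0 < α ‖s‖₊ := hα.map_zero ▸ hα.strictMono (nnnorm_pos.2 hs)
  have h2 : γ i j s ≠ 0 := abs_pos.1 (lt_of_lt_of_le (by exact_mod_cast h1) (hb s))
  exact lt_of_le_of_ne (hγ.mul_nonneg i j hij s) (mul_ne_zero hs h2).symm

theorem mul_clamp_pos {ρ s : ℝ} (hρ : 0 < ρ) (hs : s ≠ 0) : 0 < s * max (-ρ) (min s ρ) := by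
  rcases lt_or_gt_of_ne hs with h | h
  · exact mul_pos_of_neg_of_neg h (max_lt (by linarith) ((min_le_left _ _).trans_lt h))
  · exact _root_.mul_pos h (lt_max_of_lt_right (lt_min h hρ))

theorem exists_boundedCoupling_clampedCoupling {γ : Fin m → Fin m → ℝ → ℝ}
    (hγ : IsInterconnection γ) (hlip : ∀ i j, i ≠ j → LocallyLipschitz (γ i j)) {ρ : ℝ}
    (hρ : 0 < ρ) : ∃ L M, BoundedCoupling (clampedCoupling γ ρ) L M := by
  have hK : ∀ i j, ∃ K, LipschitzWith K (clampedCoupling γ ρ i j) := by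
    intro i j
    by_cases hij : i = j
    · refine ⟨0, ?_⟩
      have h : clampedCoupling γ ρ i j = fun _ => 0 := by ext; simp [clampedCoupling, hij]
      rw [h]
      exact LipschitzWith.const 0
    · obtain ⟨K, hK⟩ := (hlip i j hij).locallyLipschitzOn.exists_lipschitzOnWith_of_compact
        (isCompact_Icc (a := -ρ) (b := ρ))
      have hcl : LipschitzWith 1 fun s : ℝ => max (-ρ) (min s ρ) :=
        (LipschitzWith.id.min_const ρ).const_max (-ρ)
      have h := hK.comp (hcl.lipschitzOnWith (s := Set.univ)) fun s _ =>
        ⟨le_max_left _ _, max_le (by linarith) (min_le_right _ _)⟩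
      refine ⟨K * 1, lipschitzOnWith_univ.1 ?_⟩
      have h' : clampedCoupling γ ρ i j = γ i j ∘ fun s : ℝ => max (-ρ) (min s ρ) := by
        ext; simp [clampedCoupling, hij]
      rwa [h']
  choose K hK using hK
  have hKle : ∀ i j, K i j ≤ ∑ i, ∑ j, K i j := fun i j =>
    (Finset.single_le_sum (f := fun j => K i j) (fun _ _ => zero_le) (Finset.mem_univ j)).trans
      (Finset.single_le_sum (f := fun i => ∑ j, K i j) (fun _ _ => zero_le) (Finset.mem_univ i))
  set L := ∑ i, ∑ j, K i j
  have hL : ∀ i j, LipschitzWith L (clampedCoupling γ ρ i j) := fun i j =>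
    (hK i j).weaken (hKle i j)
  have hzero : ∀ i j, clampedCoupling γ ρ i j 0 = 0 := by
    intro i j
    by_cases hij : i = j
    · simp [clampedCoupling, hij]
    · simp [clampedCoupling, hij, hρ.le, hγ.map_zero i j hij]
  have hzp : ∀ i j, clampedCoupling γ ρ i j = 0 ∨
      ∀ s ≠ 0, 0 < s * clampedCoupling γ ρ i j s := by
    intro i j
    by_cases hij : i = j
    · left; ext; simp [clampedCoupling, hij]
    by_cases h0 : γ i j = 0
    · left; ext; simp [clampedCoupling, h0]
    right
    intro s hs
    simp only [clampedCoupling, if_neg hij]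
    -- `s` and its clamped value `c` have the same sign, so the sign of `γ i j c` is also that of
    -- `s`.
    have h1 := mul_clamp_pos hρ hs
    set c := max (-ρ) (min s ρ)
    have hc : c ≠ 0 := fun h => by simp [h] at h1
    have h2 := _root_.mul_pos h1 (hγ.mul_pos hij h0 hc)
    have h3 : s * c * (c * γ i j c) = c ^ 2 * (s * γ i j c) := by ring
    rw [h3] at h2
    exact pos_of_mul_pos_right h2 (sq_nonneg c)
  refine ⟨L, L * ρ.toNNReal, fun i j => ⟨hL i j, fun s => ?_, hzero i j, fun s => ?_, hzp i j⟩,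
    fun i => by ext; simp [clampedCoupling]⟩
  · have hcl : clampedCoupling γ ρ i j s = clampedCoupling γ ρ i j (max (-ρ) (min s ρ)) := by
      have h1 : max (-ρ) (min (max (-ρ) (min s ρ)) ρ) = max (-ρ) (min s ρ) := by
        rw [min_eq_left (max_le (by linarith) (min_le_right _ _)), max_eq_right (le_max_left _ _)]
      simp only [clampedCoupling, h1]
    have h := (hL i j).dist_le_mul (max (-ρ) (min s ρ)) 0
    rw [hzero, ← hcl, Real.dist_eq, sub_zero, Real.dist_eq, sub_zero] at h
    refine h.trans ?_
    rw [NNReal.coe_mul, Real.coe_toNNReal ρ hρ.le]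
    gcongr
    exact abs_le.2 ⟨le_max_left _ _, max_le (by linarith) (min_le_right _ _)⟩
  · rcases hzp i j with h | h
    · simp [h]
    · rcases eq_or_ne s 0 with rfl | hs
      · simp
      · exact (h s hs).le

theorem isConnected_clampedCoupling {γ : Fin m → Fin m → ℝ → ℝ} (hγ : IsInterconnection γ)
    (hconn : IsConnected (couplingGraph γ)) {ρ : ℝ} (hρ : 0 < ρ) :
    IsConnected (couplingGraph (clampedCoupling γ ρ)) := by
  obtain ⟨r, hr⟩ := hconn
  refine ⟨r, fun v hv => Relation.ReflTransGen.mono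
    (fun i j hij => ⟨hij.1, fun h => ?_⟩) v r (hr v hv)⟩
  have h1 := hγ.mul_pos hij.1 hij.2 hρ.ne'
  have h2 := congrFun h ρ
  simp only [clampedCoupling, if_neg hij.1, min_self, Pi.zero_apply,
    max_eq_right (show -ρ ≤ ρ by linarith)] at h2
  simp [h2] at h1

/-- On a compact interval both solutions have bounded disagreement, so they solve one common
clamped, globally Lipschitz system. -/
theorem rotatedArray_solution_unique {γ : Fin m → Fin m → ℝ → ℝ}
    (hγ : IsInterconnection γ) (hlip : ∀ i j, i ≠ j → LocallyLipschitz (γ i j)) {ω a b : ℝ}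
    {x y : ℝ → ArrayState m}
    (hx : IsSolutionOn (fun t x => rotatedArray γ x (ω * t)) (Set.Icc a b) x)
    (hy : IsSolutionOn (fun t x => rotatedArray γ x (ω * t)) (Set.Icc a b) y) (h : x a = y a) :
    Set.EqOn x y (Set.Icc a b) := by
  obtain ⟨A, hA⟩ := isCompact_Icc.bddAbove_image
    (continuous_disagreement.comp_continuousOn hx.continuousOn)
  obtain ⟨B, hB⟩ := isCompact_Icc.bddAbove_image
    (continuous_disagreement.comp_continuousOn hy.continuousOn)
  have hρ : 0 < max 1 (max A B) := lt_max_of_lt_left one_pos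
  obtain ⟨L, M, hg⟩ := exists_boundedCoupling_clampedCoupling hγ hlip hρ
  refine IsSolutionOn.eqOn (fun t => hg.lipschitzWith_rotatedArray (ω * t))
    (hx.congr fun t ht => (rotatedArray_clampedCoupling γ ?_ _).symm)
    (hy.congr fun t ht => (rotatedArray_clampedCoupling γ ?_ _).symm) h
  · exact (hA ⟨t, ht, rfl⟩).trans ((le_max_left _ _).trans (le_max_right _ _))
  · exact (hB ⟨t, ht, rfl⟩).trans ((le_max_right _ _).trans (le_max_right _ _))

end OscSync

/-! ### The main theorem -/

theorem mainTheorem7 {m : ℕ} (γ : Fin m → Fin m → ℝ → ℝ)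
    (hγ : OscSync.IsInterconnection γ)
    (hconn : OscSync.IsConnected (OscSync.couplingGraph γ))
    (hlip : ∀ i j, i ≠ j → LocallyLipschitz (γ i j)) :
    OscSync.SemigloballyPracticallyAsymptoticallyStable
      (fun x ω t => OscSync.rotatedArray γ x (ω * t)) (OscSync.syncManifold m) := by
  open OscSync in
  refine ⟨isClosed_syncManifold, fun Δ _ δ hδ => ?_⟩
  have hm : 0 < m := hconn.choose.pos
  have hm' : (0 : ℝ) < m := by exact_mod_cast hm
  -- The distance is at most `m * disagreement`, hence `δ / m`; the disagreement is at most twice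
  -- the distance, hence `2 * Δ` in `R`.
  set d := δ / m with hd
  have hd0 : 0 < d := by positivity
  set R := max (2 * Δ) d with hR
  have hdR : d ≤ R := le_max_right _ _
  -- Solutions of the clamped system that start at level `R` stay below `2 * R`, where clamping
  -- there has no effect.
  have hρ : 0 < 2 * R := by linarith
  obtain ⟨L, M, hg⟩ := exists_boundedCoupling_clampedCoupling hγ hlip hρ
  obtain ⟨ωstar, hωstar, hω⟩ := hg.exists_practical_bounds
    (isConnected_clampedCoupling hγ hconn hρ) hd0 hdR
  refine ⟨ωstar, hωstar, fun ω hωge => ?_⟩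
  obtain ⟨T, hT, hz⟩ := hω ω hωge
  have hstay : ∀ a T' b : ℝ, 2 * a ≤ R → (∀ (t₀ : ℝ) (z : ℝ → ArrayState m),
      IsSolutionOn (fun t x => rotatedArray (clampedCoupling γ (2 * R)) x (ω * t)) (Set.Ici t₀) z →
      disagreement (z t₀) ≤ 2 * a → ∀ t ≥ t₀, t₀ + T' ≤ t → m * disagreement (z t) ≤ b) →
      StaysWithin (fun t x => rotatedArray γ x (ω * t)) (syncManifold m) a T' b := by
    intro a T' b ha hb t₀ x₀ hx₀
    have hV : disagreement x₀ ≤ 2 * a := (disagreement_le_infDist x₀).trans (by linarith)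
    obtain ⟨z, hz0, hzs⟩ := exists_isSolutionOn_Ici
      (f := fun t x => rotatedArray (clampedCoupling γ (2 * R)) x (ω * t))
      (fun t => hg.lipschitzWith_rotatedArray (ω * t))
      (fun x => (hg.continuous_rotatedArray_right x).comp (by fun_prop))
      (fun t x => hg.norm_rotatedArray_le x (ω * t)) t₀ x₀
    have hzγ : IsSolutionOn (fun t x => rotatedArray γ x (ω * t)) (Set.Ici t₀) z :=
      hzs.congr fun t ht => rotatedArray_clampedCoupling γ
        ((hz t₀ z hzs).1 (by rw [hz0]; linarith) t ht) _
    refine ⟨⟨z, hz0, hzγ⟩, fun t₁ x hx hxs t ht hTt => ?_⟩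
    rw [rotatedArray_solution_unique hγ hlip hxs (hzγ.mono Set.Icc_subset_Ici_self)
      (hx.trans hz0.symm) ht]
    exact (infDist_syncManifold_le hm _).trans
      (hb t₀ z hzs (by rwa [hz0]) t ht.1 hTt)
  have hmd : m * d = δ := by rw [hd]; field_simp
  have hΔR : 2 * Δ ≤ R := le_max_left _ _
  refine ⟨fun r hr => ⟨d / 4, by positivity, hstay _ _ _ (by linarith) ?_⟩,
    fun ε hε => ⟨m * (2 * R), by positivity, hstay _ _ _ (by linarith) ?_⟩,
    fun r hr ε hε => ⟨T, hT, hstay _ _ _ (by linarith) ?_⟩⟩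
  · intro t₀ z hzs h t ht _
    have := mul_le_mul_of_nonneg_left ((hz t₀ z hzs).2.1 (by linarith) t ht) hm'.le
    linarith
  · intro t₀ z hzs h t ht _
    exact mul_le_mul_of_nonneg_left ((hz t₀ z hzs).1 (by linarith) t ht) hm'.le
  · intro t₀ z hzs h t _ ht
    have := mul_le_mul_of_nonneg_left ((hz t₀ z hzs).2.2 (by linarith) t ht) hm'.le
    linarith
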